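/- Let $N\ge 2$ and $a>0$, and let $g:\mathbb R\to\mathbb R$ be the $2\pi$-periodic function given on $[-\pi,\pi]$ by $g(\theta)=-\frac{a}{N-1}(\pi+\theta)$ for $\theta\in[-\pi,-\frac{\pi}{N}]$, $g(\theta)=a\theta$ for $\theta\in[-\frac{\pi}{N},\frac{\pi}{N}]$, and $g(\theta)=\frac{a}{N-1}(\pi-\theta)$ for $\theta\in[\frac{\pi}{N},\pi]$. Let $0<\delta<\frac{\pi}{N(N-1)}$, and let $f$ be a version of $g$ with its corners smoothed within distance $\delta$: $f:\mathbb R\to\mathbb R$ is continuously differentiable, $2\pi$-periodic, odd, positive on $(0,\pi)$, and $f(\theta)=g(\theta)$ for all $\theta\in[-\pi,\pi]$ with $\bigl||\theta|-\frac{\pi}{N}\bigr|\ge\delta$. Consider $N$ agents on the circle $S^1=\mathbb R/2\pi\mathbb Z$, interconnected according to a fixed connected undirected (unweighted, loopless) graph on $\{1,\dots,N\}$, and evolving by $$\frac{d}{dt}\theta_k=\sum_{j\sim k} f(\theta_j-\theta_k),\qquad k=1,\dots,N .$$ Let $V(\theta)=\frac12\sum_{k}\sum_{j\sim k} z(\theta_j-\theta_k)^2$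 on $(S^1)^N$, where $z(\theta)^2=\int_0^\theta f(s)\,ds$. Then: 1. The equilibria of the system are exactly the critical points of $V$, and for every solution $\theta:[0,\infty)\to (S^1)^N$ the distance from $\theta(t)$ to the set of critical points of $V$ tends to $0$ as $t\to\infty$. 2. Synchronization is the only asymptotically stable equilibrium. Precisely, call an equilibrium $\theta$ asymptotically stable if its configuration $\{(\theta_1+c,\dots,\theta_N+c): c\in S^1\}$ is Lyapunov stable and locally attractive; then a point $\theta\in(S^1)^N$ is an asymptotically stable equilibrium if and only if $\theta_1=\theta_2=\dots=\theta_N$. -/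

import Mathlib

open Filter Topology

noncomputable section

namespace CircleSync

/-- Positions of `N` agents on the circle (a point of the `N`-torus). `Real.Angle` is `ℝ / 2πℤ`
with its arc-length metric, and the torus carries the maximum metric. -/
abbrev Position (N : ℕ) : Type := Fin N → Real.Angle

/-- The positions on the circle of a family of real angles. -/
def proj {N : ℕ} (θ : Fin N → ℝ) : Position N := fun k => (θ k : Real.Angle)

/-- The piecewise linear coupling function `g` on the circle; `θ.toReal ∈ (-π, π]` is the
representative of the angle `θ`. Slope `a` on `[-π/N, π/N]` and slope `-a/(N-1)` elsewhere. -/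
def profile (N : ℕ) (a : ℝ) (θ : Real.Angle) : ℝ :=
  if θ.toReal < -(Real.pi / N) then -a / ((N : ℝ) - 1) * (Real.pi + θ.toReal)
  else if θ.toReal ≤ Real.pi / N then a * θ.toReal
  else a / ((N : ℝ) - 1) * (Real.pi - θ.toReal)

/-- `f` is a version of `profile N a` whose corners (at the angles `±π/N`) have been smoothed:
it is continuously differentiable, it is odd and attractive like `profile N a`, and it agrees with
`profile N a` outside the open `δ`-neighbourhoods of the two corners. -/
structure IsSmoothedProfile (N : ℕ) (a δ : ℝ) (f : Real.Angle → ℝ) : Prop where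
  contDiff : ContDiff ℝ 1 (fun s : ℝ => f (s : Real.Angle))
  odd : ∀ θ : Real.Angle, f (-θ) = -f θ
  pos : ∀ θ : Real.Angle, 0 < θ.toReal → θ.toReal < Real.pi → 0 < f θ
  eq_profile : ∀ θ : Real.Angle, δ ≤ |(|θ.toReal| - Real.pi / N)| → f θ = profile N a θ

variable {N : ℕ}

/-- The velocity `∑_{j ∼ k} f (x_j - x_k)` of agent `k`. -/
def velocity (G : SimpleGraph (Fin N)) [DecidableRel G.Adj] (f : Real.Angle → ℝ)
    (x : Position N) (k : Fin N) : ℝ :=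
  ∑ j ∈ G.neighborFinset k, f (x j - x k)

/-- `x` is a solution on `[0, ∞)`, on the torus, of `dx_k/dt = ∑_{j ∼ k} f (x_j - x_k)`.
The time derivative of a curve on the circle is that of a real lift of the curve. -/
def IsTrajectory (G : SimpleGraph (Fin N)) [DecidableRel G.Adj] (f : Real.Angle → ℝ)
    (x : ℝ → Position N) : Prop :=
  ∃ θ : ℝ → Fin N → ℝ, ∀ t : ℝ, 0 ≤ t →
    x t = proj (θ t) ∧
    ∀ k, HasDerivWithinAt (fun s => θ s k) (velocity G f (x t) k) (Set.Ici 0) t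

/-- Equilibria of the dynamics. -/
def IsEquilibrium (G : SimpleGraph (Fin N)) [DecidableRel G.Adj] (f : Real.Angle → ℝ)
    (x : Position N) : Prop :=
  ∀ k, velocity G f x k = 0

/-- The squared disagreement measure `z(θ)^2`: the primitive of the coupling function that
vanishes at `0`. -/
def zSq (f : Real.Angle → ℝ) (θ : Real.Angle) : ℝ :=
  ∫ s in (0 : ℝ)..θ.toReal, f (s : Real.Angle)

/-- `V_f (x) = (1/2) ∑_k ∑_{j ∼ k} z(x_j - x_k)^2`. -/
def potential (G : SimpleGraph (Fin N)) [DecidableRel G.Adj] (f : Real.Angle → ℝ)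
    (x : Position N) : ℝ :=
  (1 / 2) * ∑ k, ∑ j ∈ G.neighborFinset k, zSq f (x j - x k)

/-- Critical points of a function `V` on the torus: in angular coordinates, `V` is differentiable
at `x` with zero derivative. -/
def IsCriticalPoint (V : Position N → ℝ) (x : Position N) : Prop :=
  ∀ θ : Fin N → ℝ, proj θ = x →
    HasFDerivAt (fun y : Fin N → ℝ => V (proj y)) (0 : (Fin N → ℝ) →L[ℝ] ℝ) θ

/-- The configuration of `x`: all points obtained from `x` by a uniform rotation. -/
def configuration (x : Position N) : Set (Position N) :=
  Set.range fun c : Real.Angle => fun k => x k + c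

/-- Synchronization: all agents are at the same point of the circle. -/
def IsSynchronized (x : Position N) : Prop := ∀ j k, x j = x k

/-- Asymptotic stability of the configuration of `x` (stability in the sense of Lyapunov together
with local attractivity). -/
def IsAsymptoticallyStable (G : SimpleGraph (Fin N)) [DecidableRel G.Adj] (f : Real.Angle → ℝ)
    (x : Position N) : Prop :=
  (∀ ε : ℝ, 0 < ε → ∃ η : ℝ, 0 < η ∧ ∀ y : ℝ → Position N, IsTrajectory G f y →
    Metric.infDist (y 0) (configuration x) < η →
      ∀ t : ℝ, 0 ≤ t → Metric.infDist (y t) (configuration x) < ε) ∧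
  ∃ η : ℝ, 0 < η ∧ ∀ y : ℝ → Position N, IsTrajectory G f y →
    Metric.infDist (y 0) (configuration x) < η →
      Tendsto (fun t => Metric.infDist (y t) (configuration x)) atTop (𝓝 0)

end CircleSync

end

/-!
The system is the gradient flow of the potential `V`: since `f` is odd, summation by parts
(`IsSmoothedProfile.sum_coupling_mul_sub`) identifies `-∂V/∂θ_k` with the velocity of agent `k`, so
equilibria and critical points coincide. Along a trajectory `V` decreases at the rate `|velocity|²`.
As the torus is compact and the speed bounded, an excursion away from the equilibria costs a fixed
amount of `V`, whence convergence to the equilibria (`tendsto_infDist_isEquilibrium`).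

Synchronized positions are the zeros of `V ≥ 0`, so `V` is a Lyapunov function for them, and they
are attractive because every equilibrium near them is synchronized. In fact every equilibrium on an
open half-circle is synchronized, the foremost agent being pulled backwards by its neighbors
(`isSynchronized_of_lift`).

The slopes of the coupling function matter for the converse. Fix `L` with
`π / N + δ < L < π / (N - 1)`, and call an edge long if its relative angle exceeds `L`. If the edges
that are not long connect all agents, then the agents lie on an arc of length
`(N - 1) L < π`, and the equilibrium is synchronized. Otherwise some cut of the graph is crossed by
long edges only (`exists_lift_or_exists_cut`). Their relative angles are in the region where `f` is
affine with slope `-a / (N - 1)`, so rotating one side of the cut against the other strictly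
decreases `V`, to second order (`exists_potential_lt_of_cut`). A trajectory starting at such a
rotated point keeps its potential below that of the equilibrium and cannot converge to its
configuration, on which `V` is constant by rotation invariance. Such trajectories exist for all
positive times because the vector field is bounded and Lipschitz
(`exists_hasDerivWithinAt_Ici_of_lipschitzWith`).
-/

namespace CircleSync

/-! ### Functions on the circle and their real lifts -/

instance compactSpace_angle : CompactSpace Real.Angle := by
  refine ⟨?_⟩
  have h : (Set.univ : Set Real.Angle) = (fun s : ℝ => (s : Real.Angle)) ''
      Set.Icc (-Real.pi) Real.pi := by
    refine (Set.eq_univ_of_forall fun θ => ?_).symm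
    exact ⟨θ.toReal, ⟨θ.neg_pi_lt_toReal.le, θ.toReal_le_pi⟩, θ.coe_toReal⟩
  rw [h]
  exact isCompact_Icc.image Real.Angle.continuous_coe

theorem continuous_of_continuous_comp_coe {X : Type*} [TopologicalSpace X] {h : Real.Angle → X}
    (hh : Continuous fun s : ℝ => h (s : Real.Angle)) : Continuous h :=
  continuous_quot_lift (r := (QuotientAddGroup.leftRel (AddSubgroup.zmultiples (2 * Real.pi))))
    (f := fun s : ℝ => h (s : Real.Angle))
    (fun x y hxy => congrArg h (Quot.sound hxy)) hh |>.congr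
      (fun θ => by induction θ using Real.Angle.induction_on with | _ s => rfl)

theorem norm_coe_angle_le (s : ℝ) : ‖(s : Real.Angle)‖ ≤ |s| :=
  QuotientAddGroup.norm_mk_le_norm (S := AddSubgroup.zmultiples (2 * Real.pi)) (m := s)

/-- The arc-length norm on the circle is the absolute value of the representative in `(-π, π]`. -/
theorem norm_angle_eq_abs_toReal (θ : Real.Angle) : ‖θ‖ = |θ.toReal| := by
  conv_lhs => rw [← θ.coe_toReal]
  refine (AddCircle.norm_coe_eq_abs_iff (p := 2 * Real.pi) (x := θ.toReal)
    Real.two_pi_pos.ne').2 ?_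
  rw [abs_of_pos Real.two_pi_pos, mul_div_cancel_left₀ _ two_ne_zero]
  exact θ.abs_toReal_le_pi

theorem exists_toReal_coe_eq (s : ℝ) : ∃ n : ℤ, s = (s : Real.Angle).toReal + n * (2 * Real.pi) := by
  have h : ((s : Real.Angle).toReal : Real.Angle) = s := Real.Angle.coe_toReal _
  obtain ⟨n, hn⟩ := Real.Angle.angle_eq_iff_two_pi_dvd_sub.1 h
  exact ⟨-n, by push_cast; linarith⟩

/-- The primitive, vanishing at `0`, of the real lift of a coupling function. -/
noncomputable def primitive (f : Real.Angle → ℝ) (s : ℝ) : ℝ :=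
  ∫ u in (0 : ℝ)..s, f (u : Real.Angle)

section

variable {N : ℕ} {a δ : ℝ} {f : Real.Angle → ℝ}

theorem lift_periodic (f : Real.Angle → ℝ) :
    Function.Periodic (fun s : ℝ => f (s : Real.Angle)) (2 * Real.pi) := by
  intro s
  simp

theorem IsSmoothedProfile.continuous_lift (hf : IsSmoothedProfile N a δ f) :
    Continuous fun s : ℝ => f (s : Real.Angle) :=
  hf.contDiff.continuous

theorem IsSmoothedProfile.continuous (hf : IsSmoothedProfile N a δ f) : Continuous f :=
  continuous_of_continuous_comp_coe hf.continuous_lift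

theorem IsSmoothedProfile.map_zero (hf : IsSmoothedProfile N a δ f) : f 0 = 0 := by
  have := hf.odd 0
  rw [neg_zero] at this
  linarith

theorem IsSmoothedProfile.lift_pos (hf : IsSmoothedProfile N a δ f) {s : ℝ} (h0 : 0 < s)
    (h1 : s < Real.pi) : 0 < f (s : Real.Angle) := by
  have h : (s : Real.Angle).toReal = s :=
    Real.Angle.toReal_coe_eq_self_iff.2 ⟨by linarith, h1.le⟩
  exact hf.pos _ (by rwa [h]) (by rwa [h])

theorem IsSmoothedProfile.lift_neg (hf : IsSmoothedProfile N a δ f) {s : ℝ} (h0 : s < 0)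
    (h1 : -Real.pi < s) : f (s : Real.Angle) < 0 := by
  have h := hf.lift_pos (s := -s) (by linarith) (by linarith)
  rw [Real.Angle.coe_neg, hf.odd] at h
  linarith

theorem IsSmoothedProfile.hasDerivAt_primitive (hf : IsSmoothedProfile N a δ f) (s : ℝ) :
    HasDerivAt (primitive f) (f (s : Real.Angle)) s :=
  intervalIntegral.integral_hasDerivAt_right (hf.continuous_lift.intervalIntegrable _ _)
    (hf.continuous_lift.stronglyMeasurableAtFilter _ _) hf.continuous_lift.continuousAt

theorem IsSmoothedProfile.primitive_neg (hf : IsSmoothedProfile N a δ f) (s : ℝ) :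
    primitive f (-s) = primitive f s := by
  have h := intervalIntegral.integral_comp_neg (a := 0) (b := s)
    (fun u : ℝ => f (u : Real.Angle))
  simp only [Real.Angle.coe_neg, hf.odd, intervalIntegral.integral_neg, neg_zero] at h
  rw [primitive, primitive, intervalIntegral.integral_symm, ← h, neg_neg]

theorem IsSmoothedProfile.primitive_sub (hf : IsSmoothedProfile N a δ f) (s t : ℝ) :
    primitive f t - primitive f s = ∫ u in s..t, f (u : Real.Angle) :=
  intervalIntegral.integral_interval_sub_left (hf.continuous_lift.intervalIntegrable _ _)
    (hf.continuous_lift.intervalIntegrable _ _)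

theorem IsSmoothedProfile.primitive_periodic (hf : IsSmoothedProfile N a δ f) :
    Function.Periodic (primitive f) (2 * Real.pi) := by
  intro s
  -- The mean of an odd periodic function vanishes: integrate over `[-π, π]`.
  have h := hf.primitive_sub s (s + 2 * Real.pi)
  rw [(lift_periodic f).intervalIntegral_add_eq s (-Real.pi), ← hf.primitive_sub,
    show -Real.pi + 2 * Real.pi = Real.pi by ring, hf.primitive_neg] at h
  linarith

/-- `zSq` is defined through the representative in `(-π, π]`, but by periodicity of the primitive
any real lift may be used. -/
theorem IsSmoothedProfile.zSq_coe (hf : IsSmoothedProfile N a δ f) (s : ℝ) :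
    zSq f (s : Real.Angle) = primitive f s := by
  obtain ⟨n, hn⟩ := exists_toReal_coe_eq s
  change primitive f (s : Real.Angle).toReal = primitive f s
  conv_rhs => rw [hn]
  exact ((hf.primitive_periodic.int_mul n) _).symm

theorem zSq_zero (f : Real.Angle → ℝ) : zSq f 0 = 0 := by
  simp [zSq]

theorem IsSmoothedProfile.continuous_zSq (hf : IsSmoothedProfile N a δ f) :
    Continuous (zSq f) := by
  refine continuous_of_continuous_comp_coe ?_
  simp only [hf.zSq_coe]
  exact continuous_iff_continuousAt.2 fun s => (hf.hasDerivAt_primitive s).continuousAt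

theorem IsSmoothedProfile.zSq_pos (hf : IsSmoothedProfile N a δ f) {θ : Real.Angle}
    (hθ : θ ≠ 0) : 0 < zSq f θ := by
  have key : ∀ s : ℝ, 0 < s → s ≤ Real.pi → 0 < primitive f s := fun s h0 h1 =>
    intervalIntegral.intervalIntegral_pos_of_pos_on (hf.continuous_lift.intervalIntegrable _ _)
      (fun u hu => hf.lift_pos hu.1 (hu.2.trans_le h1)) h0
  have hne : θ.toReal ≠ 0 := fun h => hθ (Real.Angle.toReal_eq_zero_iff.1 h)
  change 0 < primitive f θ.toReal
  rcases hne.lt_or_gt with h | h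
  · rw [← hf.primitive_neg]
    exact key _ (by linarith) (by linarith [θ.neg_pi_lt_toReal])
  · exact key _ h θ.toReal_le_pi

theorem IsSmoothedProfile.zSq_nonneg (hf : IsSmoothedProfile N a δ f) (θ : Real.Angle) :
    0 ≤ zSq f θ := by
  by_cases h : θ = 0
  · rw [h, zSq_zero]
  · exact (hf.zSq_pos h).le

/-- Away from the corners, on the arc through the antipodal point, the coupling function is affine
with negative slope. -/
theorem IsSmoothedProfile.lift_eq_of_mem_Icc (hf : IsSmoothedProfile N a δ f) (hδ : 0 < δ)
    {s : ℝ} (h0 : Real.pi / N + δ ≤ s) (h1 : s ≤ 2 * Real.pi - (Real.pi / N + δ)) :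
    f (s : Real.Angle) = a / ((N : ℝ) - 1) * (Real.pi - s) := by
  have hN : 0 ≤ Real.pi / N := by positivity
  rcases le_or_gt s Real.pi with h | h
  · have ht : (s : Real.Angle).toReal = s :=
      Real.Angle.toReal_coe_eq_self_iff.2 ⟨by linarith, h⟩
    rw [hf.eq_profile, profile, ht, if_neg (by linarith), if_neg (by linarith)]
    rw [ht, abs_of_pos (show 0 < s by linarith)]
    exact le_trans (by linarith) (le_abs_self _)
  · have ht : (s : Real.Angle).toReal = s - 2 * Real.pi :=
      Real.Angle.toReal_coe_eq_self_sub_two_pi_iff.2 ⟨h, by linarith⟩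
    rw [hf.eq_profile, profile, ht, if_pos (by linarith)]
    · ring
    rw [ht, abs_of_neg (show s - 2 * Real.pi < 0 by linarith)]
    exact le_trans (by linarith) (le_abs_self _)

/-- At relative angles farther than `ρ` from the smoothed corners, on the arc of negative slope,
the primitive is exactly a concave quadratic polynomial in displacements of size at most `ρ`. -/
theorem IsSmoothedProfile.primitive_add_sub (hf : IsSmoothedProfile N a δ f) (hδ : 0 < δ)
    {ρ d u : ℝ} (hd : Real.pi / N + δ + ρ ≤ |(d : Real.Angle).toReal|) (hu : |u| ≤ ρ) :
    primitive f (d + u) - primitive f d =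
      f (d : Real.Angle) * u - a / ((N : ℝ) - 1) * u ^ 2 / 2 := by
  have main : ∀ e : ℝ, Real.pi / N + δ + ρ ≤ e → e ≤ 2 * Real.pi - (Real.pi / N + δ + ρ) →
      primitive f (e + u) - primitive f e =
        f (e : Real.Angle) * u - a / ((N : ℝ) - 1) * u ^ 2 / 2 := by
    intro e h0 h1
    have hu' := abs_le.1 hu
    have hρ : 0 ≤ ρ := (abs_nonneg u).trans hu
    have hcongr : ∫ s in e..e + u, f (s : Real.Angle) =
        ∫ s in e..e + u, a / ((N : ℝ) - 1) * (Real.pi - s) := by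
      refine intervalIntegral.integral_congr fun s hs => ?_
      rw [Set.mem_uIcc] at hs
      refine hf.lift_eq_of_mem_Icc hδ ?_ ?_ <;> rcases hs with hs | hs <;> linarith [hs.1, hs.2]
    rw [hf.primitive_sub, hcongr, hf.lift_eq_of_mem_Icc hδ (by linarith) (by linarith),
      intervalIntegral.integral_const_mul, intervalIntegral.integral_sub (by simp) (by simp)]
    simp only [intervalIntegral.integral_const, integral_id, smul_eq_mul]
    ring
  have transfer : ∀ n : ℤ, Real.pi / N + δ + ρ ≤ d - n * (2 * Real.pi) →
      d - n * (2 * Real.pi) ≤ 2 * Real.pi - (Real.pi / N + δ + ρ) →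
      primitive f (d + u) - primitive f d =
        f (d : Real.Angle) * u - a / ((N : ℝ) - 1) * u ^ 2 / 2 := by
    intro n h0 h1
    have h := main _ h0 h1
    rwa [show d - n * (2 * Real.pi) + u = d + u - n * (2 * Real.pi) by ring,
      hf.primitive_periodic.sub_int_mul_eq n, hf.primitive_periodic.sub_int_mul_eq n,
      (lift_periodic f).sub_int_mul_eq n] at h
  obtain ⟨n, hn⟩ := exists_toReal_coe_eq d
  have hpi := Real.pi_pos
  have hle := (d : Real.Angle).toReal_le_pi
  have hlt := (d : Real.Angle).neg_pi_lt_toReal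
  rcases le_total 0 (d : Real.Angle).toReal with h | h
  · rw [abs_of_nonneg h] at hd
    exact transfer n (by linarith) (by linarith)
  · rw [abs_of_nonpos h] at hd
    exact transfer (n - 1) (by push_cast; linarith) (by push_cast; linarith)

end

section

variable {N : ℕ} {a δ : ℝ} {f : Real.Angle → ℝ} (G : SimpleGraph (Fin N)) [DecidableRel G.Adj]

/-! ### The potential and its gradient -/

theorem exists_proj_eq (x : Position N) : ∃ θ : Fin N → ℝ, proj θ = x :=
  ⟨fun k => (x k).toReal, funext fun k => (x k).coe_toReal⟩

theorem sum_neighborFinset_swap (w : Fin N → Fin N → ℝ) :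
    ∑ k, ∑ j ∈ G.neighborFinset k, w k j = ∑ k, ∑ j ∈ G.neighborFinset k, w j k := by
  simp only [SimpleGraph.neighborFinset_eq_filter, Finset.sum_filter]
  rw [Finset.sum_comm]
  simp only [G.adj_comm]

theorem velocity_proj (f : Real.Angle → ℝ) (θ : Fin N → ℝ) (k : Fin N) :
    velocity G f (proj θ) k = ∑ j ∈ G.neighborFinset k, f ((θ j - θ k : ℝ) : Real.Angle) := rfl

/-- Summation by parts for the antisymmetric interaction: pairing the couplings with the relative
displacements of the agents amounts to pairing the velocities with the displacements. -/
theorem IsSmoothedProfile.sum_coupling_mul_sub (hf : IsSmoothedProfile N a δ f)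
    (x : Position N) (h : Fin N → ℝ) :
    ∑ k, ∑ j ∈ G.neighborFinset k, f (x j - x k) * (h j - h k) =
      -2 * ∑ k, velocity G f x k * h k := by
  have h1 : ∑ k, ∑ j ∈ G.neighborFinset k, f (x j - x k) * h k = ∑ k, velocity G f x k * h k :=
    Finset.sum_congr rfl fun k _ => by rw [velocity, Finset.sum_mul]
  have h2 : ∑ k, ∑ j ∈ G.neighborFinset k, f (x j - x k) * h j =
      -∑ k, velocity G f x k * h k := by
    rw [sum_neighborFinset_swap, ← h1, ← Finset.sum_neg_distrib]
    refine Finset.sum_congr rfl fun k _ => ?_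
    rw [← Finset.sum_neg_distrib]
    refine Finset.sum_congr rfl fun j _ => ?_
    rw [← neg_sub, hf.odd, neg_mul]
  simp only [mul_sub, Finset.sum_sub_distrib, h1, h2]
  ring

theorem IsSmoothedProfile.potential_proj (hf : IsSmoothedProfile N a δ f) (θ : Fin N → ℝ) :
    potential G f (proj θ) =
      (1 / 2) * ∑ k, ∑ j ∈ G.neighborFinset k, primitive f (θ j - θ k) := by
  simp only [potential, ← hf.zSq_coe]
  rfl

/-- The dynamics is the gradient flow of the potential: in angular coordinates, the derivative of
the potential is minus the pairing with the velocity. -/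
theorem IsSmoothedProfile.hasFDerivAt_potential (hf : IsSmoothedProfile N a δ f)
    (θ : Fin N → ℝ) :
    HasFDerivAt (fun y : Fin N → ℝ => potential G f (proj y))
      (-∑ k, velocity G f (proj θ) k • ContinuousLinearMap.proj (R := ℝ) (φ := fun _ => ℝ) k)
      θ := by
  have h : HasFDerivAt
      (fun y : Fin N → ℝ => (1 / 2) * ∑ k, ∑ j ∈ G.neighborFinset k, primitive f (y j - y k))
      ((1 / 2 : ℝ) • ∑ k, ∑ j ∈ G.neighborFinset k, f ((θ j - θ k : ℝ) : Real.Angle) •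
        (ContinuousLinearMap.proj (R := ℝ) (φ := fun _ => ℝ) j -
          ContinuousLinearMap.proj (R := ℝ) (φ := fun _ => ℝ) k)) θ := by
    refine HasFDerivAt.const_mul (HasFDerivAt.fun_sum fun k _ => HasFDerivAt.fun_sum fun j _ => ?_) _
    have hsub : HasFDerivAt (fun y : Fin N → ℝ => y j - y k)
        (ContinuousLinearMap.proj (R := ℝ) (φ := fun _ => ℝ) j -
          ContinuousLinearMap.proj (R := ℝ) (φ := fun _ => ℝ) k) θ :=
      (hasFDerivAt_apply j θ).fun_sub (hasFDerivAt_apply k θ)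
    exact (hf.hasDerivAt_primitive (θ j - θ k)).comp_hasFDerivAt θ hsub
  simp only [hf.potential_proj G]
  refine h.congr_fderiv ?_
  ext1 v
  have key := hf.sum_coupling_mul_sub G (proj θ) v
  simp only [smul_apply, sum_apply,
    sub_apply, neg_apply, ContinuousLinearMap.proj_apply,
    smul_eq_mul]
  change 1 / 2 * ∑ k, ∑ j ∈ G.neighborFinset k, f (proj θ j - proj θ k) * (v j - v k) = _
  rw [key]
  ring

theorem IsSmoothedProfile.isEquilibrium_iff_isCriticalPoint (hf : IsSmoothedProfile N a δ f)
    (x : Position N) : IsEquilibrium G f x ↔ IsCriticalPoint (potential G f) x := by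
  constructor
  · rintro hx θ rfl
    have h := hf.hasFDerivAt_potential G θ
    simpa only [hx _, zero_smul, Finset.sum_const_zero, neg_zero] using h
  · intro hx k
    obtain ⟨θ, rfl⟩ := exists_proj_eq x
    have h := (hf.hasFDerivAt_potential G θ).unique (hx θ rfl)
    have hk := DFunLike.congr_fun h (Pi.single k 1)
    simpa [sum_apply, Pi.single_apply] using hk

theorem IsSmoothedProfile.continuous_velocity (hf : IsSmoothedProfile N a δ f) (k : Fin N) :
    Continuous fun x : Position N => velocity G f x k :=
  continuous_finsetSum _ fun j _ =>
    hf.continuous.comp ((continuous_apply j).sub (continuous_apply k))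

theorem IsSmoothedProfile.continuous_potential (hf : IsSmoothedProfile N a δ f) :
    Continuous (potential G f) :=
  continuous_const.mul <| continuous_finsetSum _ fun k _ => continuous_finsetSum _ fun j _ =>
    hf.continuous_zSq.comp ((continuous_apply j).sub (continuous_apply k))

theorem IsSmoothedProfile.potential_nonneg (hf : IsSmoothedProfile N a δ f) (x : Position N) :
    0 ≤ potential G f x :=
  mul_nonneg (by norm_num) <| Finset.sum_nonneg fun _ _ => Finset.sum_nonneg fun _ _ =>
    hf.zSq_nonneg _

/-- A function on the vertices of a connected graph which agrees on adjacent vertices is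
constant. -/
theorem eq_of_forall_adj_eq {V X : Type*} {G : SimpleGraph V} (hG : G.Connected) {x : V → X}
    (h : ∀ i j, G.Adj i j → x i = x j) (i j : V) : x i = x j := by
  obtain ⟨p⟩ := hG.preconnected i j
  induction p with
  | nil => rfl
  | cons hadj _ ih => exact (h _ _ hadj).trans ih

variable {G} in
theorem IsSmoothedProfile.potential_eq_zero_iff (hf : IsSmoothedProfile N a δ f)
    (hG : G.Connected) (x : Position N) : potential G f x = 0 ↔ IsSynchronized x := by
  constructor
  · intro h j k
    refine eq_of_forall_adj_eq hG (fun i l hil => ?_) j k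
    have hsum : ∑ k, ∑ j ∈ G.neighborFinset k, zSq f (x j - x k) = 0 := by
      rw [potential] at h
      linarith
    rw [Finset.sum_eq_zero_iff_of_nonneg fun _ _ => Finset.sum_nonneg fun _ _ =>
      hf.zSq_nonneg _] at hsum
    have hl := hsum l (Finset.mem_univ l)
    rw [Finset.sum_eq_zero_iff_of_nonneg fun _ _ => hf.zSq_nonneg _] at hl
    by_contra hne
    exact (hf.zSq_pos (sub_ne_zero.2 hne)).ne'
      (hl i ((G.mem_neighborFinset l i).2 hil.symm))
  · intro h
    have hz : ∀ j k, zSq f (x j - x k) = 0 := fun j k => by rw [h j k, sub_self, zSq_zero]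
    simp [potential, hz]

theorem potential_add_const (f : Real.Angle → ℝ) (x : Position N) (c : Real.Angle) :
    potential G f (fun k => x k + c) = potential G f x := by
  simp [potential]

variable {G} in
theorem IsSmoothedProfile.isEquilibrium_of_isSynchronized (hf : IsSmoothedProfile N a δ f)
    {x : Position N} (hx : IsSynchronized x) : IsEquilibrium G f x := fun k =>
  Finset.sum_eq_zero fun j _ => by rw [hx j k, sub_self, hf.map_zero]

end

/-! ### Autonomous differential equations with a bounded Lipschitz field -/

/-- A bounded Lipschitz vector field has integral curves defined for all nonnegative times: on
`[0, n]` the bound allows Picard–Lindelöf in a single step, and these solutions agree on common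
intervals. -/
theorem exists_hasDerivWithinAt_Ici_of_lipschitzWith {E : Type*} [NormedAddCommGroup E]
    [NormedSpace ℝ E] [CompleteSpace E] {v : E → E} {K : NNReal} (hv : LipschitzWith K v)
    {C : ℝ} (hC : ∀ x, ‖v x‖ ≤ C) (x₀ : E) :
    ∃ α : ℝ → E, α 0 = x₀ ∧ ∀ t, 0 ≤ t → HasDerivWithinAt α (v (α t)) (Set.Ici 0) t := by
  have hC0 : 0 ≤ C := (norm_nonneg _).trans (hC x₀)
  have hex : ∀ n : ℕ, ∃ α : ℝ → E, α 0 = x₀ ∧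
      ∀ t ∈ Set.Icc (0 : ℝ) n, HasDerivWithinAt α (v (α t)) (Set.Icc 0 n) t := by
    intro n
    have hn : (0 : ℝ) ≤ n := n.cast_nonneg
    have hPL : IsPicardLindelof (fun _ : ℝ => v) (tmin := 0) (tmax := n)
        ⟨0, Set.left_mem_Icc.2 hn⟩ x₀ (Real.toNNReal (C * n)) 0 (Real.toNNReal C) K := by
      refine ⟨fun _ _ => hv.lipschitzOnWith, fun _ _ => continuousOn_const, fun _ _ x _ => ?_, ?_⟩
      · rw [Real.coe_toNNReal _ hC0]
        exact hC x
      · rw [Real.coe_toNNReal _ hC0, Real.coe_toNNReal _ (by positivity)]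
        simp
    exact hPL.exists_eq_forall_mem_Icc_hasDerivWithinAt₀
  choose β hβ0 hβ using hex
  have hagree : ∀ n m : ℕ, n ≤ m → Set.EqOn (β n) (β m) (Set.Icc 0 n) := by
    intro n m hnm
    have hnm' : (n : ℝ) ≤ m := Nat.cast_le.2 hnm
    have hright : ∀ (p : ℕ), n ≤ p → ∀ t ∈ Set.Ico (0 : ℝ) n,
        HasDerivWithinAt (β p) (v (β p t)) (Set.Ici t) t := by
      intro p hp t ht
      have htp : t < p := ht.2.trans_le (Nat.cast_le.2 hp)
      refine (hβ p t ⟨ht.1, htp.le⟩).mono_of_mem_nhdsWithin ?_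
      filter_upwards [self_mem_nhdsWithin, mem_nhdsWithin_of_mem_nhds (Iio_mem_nhds htp)]
        with s hs hs' using ⟨ht.1.trans hs, le_of_lt hs'⟩
    refine ODE_solution_unique (v := fun _ => v) (fun _ => hv)
      (fun t ht => (hβ n t ht).continuousWithinAt) (hright n le_rfl)
      (fun t ht => ((hβ m t ⟨ht.1, ht.2.trans hnm'⟩).continuousWithinAt).mono
        (Set.Icc_subset_Icc_right hnm')) (hright m hnm) ((hβ0 n).trans (hβ0 m).symm)
  have hglue : ∀ (n : ℕ) (s : ℝ), 0 ≤ s → s ≤ n → β ⌈s⌉₊ s = β n s := fun n s h0 hs =>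
    hagree _ n (Nat.ceil_le.2 hs) ⟨h0, Nat.le_ceil s⟩
  refine ⟨fun t => β ⌈t⌉₊ t, by simp [hβ0], fun t ht => ?_⟩
  have htn : t < ((⌈t⌉₊ + 1 : ℕ) : ℝ) := by
    push_cast
    linarith [Nat.le_ceil t]
  have hd := hβ (⌈t⌉₊ + 1) t ⟨ht, htn.le⟩
  have hmem : Set.Icc (0 : ℝ) ((⌈t⌉₊ + 1 : ℕ) : ℝ) ∈ 𝓝[Set.Ici 0] t := by
    filter_upwards [self_mem_nhdsWithin, mem_nhdsWithin_of_mem_nhds (Iio_mem_nhds htn)]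
      with s hs hs' using ⟨hs, le_of_lt hs'⟩
  have hd' := hd.mono_of_mem_nhdsWithin hmem
  rw [← hglue _ t ht htn.le] at hd'
  refine hd'.congr_of_eventuallyEq ?_ (hglue _ t ht htn.le)
  filter_upwards [hmem] with s hs using hglue _ s hs.1 hs.2

section

variable {N : ℕ} {a δ : ℝ} {f : Real.Angle → ℝ} (G : SimpleGraph (Fin N)) [DecidableRel G.Adj]

/-! ### Trajectories of the coupled agents -/

theorem IsSmoothedProfile.exists_norm_velocity_le (hf : IsSmoothedProfile N a δ f) :
    ∃ C, 0 < C ∧ ∀ x, ‖velocity G f x‖ ≤ C := by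
  obtain ⟨C, hC⟩ := isCompact_univ.exists_bound_of_continuousOn
    (continuous_pi fun k => hf.continuous_velocity G k).continuousOn
  exact ⟨max C 1, by positivity, fun x => (hC x (Set.mem_univ x)).trans (le_max_left _ _)⟩

theorem IsSmoothedProfile.exists_lipschitzWith_lift (hf : IsSmoothedProfile N a δ f) :
    ∃ K, LipschitzWith K fun s : ℝ => f (s : Real.Angle) := by
  have hper : Function.Periodic (deriv fun s : ℝ => f (s : Real.Angle)) (2 * Real.pi) := by
    intro s
    rw [← deriv_comp_add_const]
    exact congrArg (fun g => deriv g s) (funext (lift_periodic f))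
  obtain ⟨C, hC⟩ := (hper.isBounded_of_continuous Real.two_pi_pos.ne'
    (hf.contDiff.continuous_deriv le_rfl)).exists_norm_le
  refine ⟨Real.toNNReal C, lipschitzWith_of_nnnorm_deriv_le
    (hf.contDiff.differentiable one_ne_zero) fun s => ?_⟩
  rw [← norm_toNNReal]
  exact Real.toNNReal_le_toNNReal (hC _ (Set.mem_range_self s))

theorem IsSmoothedProfile.exists_lipschitzWith_velocity (hf : IsSmoothedProfile N a δ f) :
    ∃ K, LipschitzWith K fun θ : Fin N → ℝ => velocity G f (proj θ) := by
  obtain ⟨K, hK⟩ := hf.exists_lipschitzWith_lift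
  refine ⟨N * (K * 2), LipschitzWith.of_dist_le_mul fun θ η => ?_⟩
  refine (dist_pi_le_iff (by positivity)).2 fun k => ?_
  rw [velocity_proj, velocity_proj]
  refine (dist_sum_sum_le_of_le (d := fun _ => K * (2 * dist θ η)) _ fun j _ => ?_).trans ?_
  · refine (hK.dist_le_mul _ _).trans (mul_le_mul_of_nonneg_left ?_ K.2)
    have h := dist_sub_sub_le (θ j) (θ k) (η j) (η k)
    have hj := dist_le_pi_dist θ η j
    have hk := dist_le_pi_dist θ η k
    linarith
  · have hcard : ((G.neighborFinset k).card : ℝ) ≤ N := by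
      exact_mod_cast (Finset.card_le_univ _).trans_eq (Fintype.card_fin N)
    rw [Finset.sum_const, nsmul_eq_mul]
    push_cast
    calc _ ≤ (N : ℝ) * (K * (2 * dist θ η)) := mul_le_mul_of_nonneg_right hcard (by positivity)
      _ = _ := by ring

theorem IsSmoothedProfile.exists_isTrajectory (hf : IsSmoothedProfile N a δ f)
    (x : Position N) : ∃ y, IsTrajectory G f y ∧ y 0 = x := by
  obtain ⟨θ₀, rfl⟩ := exists_proj_eq x
  obtain ⟨K, hK⟩ := hf.exists_lipschitzWith_velocity G
  obtain ⟨C, -, hC⟩ := hf.exists_norm_velocity_le G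
  obtain ⟨θ, h0, hθ⟩ := exists_hasDerivWithinAt_Ici_of_lipschitzWith hK (fun η => hC (proj η)) θ₀
  exact ⟨fun t => proj (θ t), ⟨θ, fun t ht => ⟨rfl, hasDerivWithinAt_pi.1 (hθ t ht)⟩⟩, congrArg proj h0⟩

variable {G}

theorem IsSmoothedProfile.hasDerivWithinAt_potential (hf : IsSmoothedProfile N a δ f)
    {x : ℝ → Position N} (hx : IsTrajectory G f x) {t : ℝ} (ht : 0 ≤ t) :
    HasDerivWithinAt (fun s => potential G f (x s)) (-∑ k, velocity G f (x t) k ^ 2)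
      (Set.Ici 0) t := by
  obtain ⟨θ, hθ⟩ := hx
  have h1 : HasDerivWithinAt θ (velocity G f (x t)) (Set.Ici 0) t :=
    hasDerivWithinAt_pi.2 (hθ t ht).2
  have h2 := (hf.hasFDerivAt_potential G (θ t)).comp_hasDerivWithinAt t h1
  rw [← (hθ t ht).1] at h2
  refine (h2.congr_deriv ?_).congr_of_mem (fun s hs => ?_) ht
  · simp [sum_apply, sq]
  · simp only [Function.comp_apply, ← (hθ s hs).1]

/-- Energy dissipation: where the speed stays bounded below, the potential drops linearly. -/
theorem IsSmoothedProfile.potential_add_mul_le (hf : IsSmoothedProfile N a δ f)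
    {x : ℝ → Position N} (hx : IsTrajectory G f x) {s t c : ℝ} (hs : 0 ≤ s) (hst : s ≤ t)
    (hc : ∀ r ∈ Set.Icc s t, c ≤ ∑ k, velocity G f (x r) k ^ 2) :
    potential G f (x t) + c * (t - s) ≤ potential G f (x s) := by
  have hd : ∀ r ∈ Set.Icc s t, HasDerivWithinAt (fun r => potential G f (x r) + c * r)
      (-∑ k, velocity G f (x r) k ^ 2 + c) (Set.Icc s t) r := fun r hr =>
    ((hf.hasDerivWithinAt_potential hx (hs.trans hr.1)).mono fun u hu => hs.trans hu.1).fun_add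
      (by simpa using (hasDerivWithinAt_id r (Set.Icc s t)).const_mul c)
  have hanti : AntitoneOn (fun r => potential G f (x r) + c * r) (Set.Icc s t) := by
    refine antitoneOn_of_hasDerivWithinAt_nonpos (convex_Icc s t)
      (fun r hr => (hd r hr).continuousWithinAt)
      (fun r hr => (hd r (interior_subset hr)).mono interior_subset) fun r hr => ?_
    linarith [hc r (interior_subset hr)]
  have h := hanti (Set.left_mem_Icc.2 hst) (Set.right_mem_Icc.2 hst) hst
  simp only at h
  linarith

theorem IsSmoothedProfile.potential_antitone (hf : IsSmoothedProfile N a δ f)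
    {x : ℝ → Position N} (hx : IsTrajectory G f x) {s t : ℝ} (hs : 0 ≤ s) (hst : s ≤ t) :
    potential G f (x t) ≤ potential G f (x s) := by
  simpa using hf.potential_add_mul_le hx hs hst (c := 0)
    fun r _ => Finset.sum_nonneg fun k _ => sq_nonneg _

theorem dist_proj_le (θ η : Fin N → ℝ) : dist (proj θ) (proj η) ≤ dist θ η := by
  refine (dist_pi_le_iff dist_nonneg).2 fun k => ?_
  refine le_trans ?_ (dist_le_pi_dist θ η k)
  rw [dist_eq_norm, Real.dist_eq]
  exact norm_coe_angle_le (θ k - η k)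

theorem IsTrajectory.dist_le {x : ℝ → Position N} (hx : IsTrajectory G f x) {C : ℝ}
    (hC : ∀ x, ‖velocity G f x‖ ≤ C) {s t : ℝ} (hs : 0 ≤ s) (ht : 0 ≤ t) :
    dist (x t) (x s) ≤ C * |t - s| := by
  obtain ⟨θ, hθ⟩ := hx
  rw [(hθ s hs).1, (hθ t ht).1]
  refine (dist_proj_le _ _).trans ?_
  rw [dist_eq_norm, ← Real.norm_eq_abs]
  exact (convex_Ici (0 : ℝ)).norm_image_sub_le_of_norm_hasDerivWithin_le
    (fun r hr => hasDerivWithinAt_pi.2 (hθ r hr).2) (fun r _ => hC _) hs ht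

/-- On a compact space, smallness of a nonnegative function forces smallness of every function
that is nonpositive on its zero set. -/
theorem exists_pos_forall_lt_of_compactSpace {X : Type*} [TopologicalSpace X] [CompactSpace X]
    {u v : X → ℝ} (hu : Continuous u) (hv : Continuous v) (hu0 : ∀ x, 0 ≤ u x)
    (h : ∀ x, u x = 0 → v x ≤ 0) {ε : ℝ} (hε : 0 < ε) :
    ∃ η, 0 < η ∧ ∀ x, u x < η → v x < ε := by
  have hK : IsCompact {x | ε ≤ v x} := (isClosed_le continuous_const hv).isCompact
  rcases Set.eq_empty_or_nonempty {x | ε ≤ v x} with he | hne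
  · refine ⟨1, one_pos, fun x _ => lt_of_not_ge fun hx => ?_⟩
    have hmem : x ∈ {x | ε ≤ v x} := hx
    rw [he] at hmem
    exact hmem
  · obtain ⟨m, hm, hmin⟩ := hK.exists_isMinOn hne hu.continuousOn
    refine ⟨u m, (hu0 m).lt_of_ne fun h0 => ?_, fun x hx => lt_of_not_ge fun hvx => ?_⟩
    · exact (hε.trans_le hm).not_ge (h m h0.symm)
    · exact hx.not_ge (hmin hvx)

/-- LaSalle's invariance principle for the gradient flow. The potential converges along a
trajectory; since the speed is bounded, an excursion of size `ε` away from the equilibria lasts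
for a time bounded below and costs a fixed amount of potential. -/
theorem IsSmoothedProfile.tendsto_infDist_isEquilibrium (hf : IsSmoothedProfile N a δ f)
    {x : ℝ → Position N} (hx : IsTrajectory G f x) :
    Tendsto (fun t => Metric.infDist (x t) {y | IsEquilibrium G f y}) atTop (𝓝 0) := by
  obtain ⟨C, hC0, hC⟩ := hf.exists_norm_velocity_le G
  rw [Metric.tendsto_atTop]
  intro ε hε
  have hcont : Continuous fun y : Position N => ∑ k, velocity G f y k ^ 2 :=
    continuous_finsetSum _ fun k _ => (hf.continuous_velocity G k).pow 2
  obtain ⟨η, hη, hηE⟩ := exists_pos_forall_lt_of_compactSpace hcont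
    (Metric.continuous_infDist_pt {y | IsEquilibrium G f y})
    (fun y => Finset.sum_nonneg fun k _ => sq_nonneg _) (fun y hy => by
      have heq : y ∈ {y | IsEquilibrium G f y} := fun k => pow_eq_zero_iff two_ne_zero |>.1 <|
        (Finset.sum_eq_zero_iff_of_nonneg fun k _ => sq_nonneg (velocity G f y k)).1 hy k
          (Finset.mem_univ k)
      exact (Metric.infDist_zero_of_mem heq).le) (half_pos hε)
  -- A trajectory needs at least the time `τ` to travel the distance `ε / 2`.
  set τ : ℝ := ε / (2 * C) with hτ
  have hτ0 : 0 < τ := by positivity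
  set S : Set ℝ := (fun t => potential G f (x t)) '' Set.Ici 0
  have hS : BddBelow S := ⟨0, by
    rintro _ ⟨t, -, rfl⟩
    exact hf.potential_nonneg G _⟩
  obtain ⟨_, ⟨T, hT0, rfl⟩, hT⟩ := Real.lt_sInf_add_pos (s := S)
    ⟨_, Set.mem_image_of_mem _ Set.self_mem_Ici⟩ (mul_pos hη hτ0)
  refine ⟨T, fun t ht => ?_⟩
  have ht0 : 0 ≤ t := le_trans hT0 ht
  rw [Real.dist_0_eq_abs, abs_of_nonneg Metric.infDist_nonneg]
  by_contra! hfar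
  have hdrop := hf.potential_add_mul_le hx ht0 (t := t + τ) (by linarith) (c := η) fun r hr => by
    by_contra! hr'
    have h1 := hηE _ hr'
    have h2 := Metric.infDist_le_infDist_add_dist (s := {y | IsEquilibrium G f y})
      (x := x t) (y := x r)
    have h3 := hx.dist_le hC (ht0.trans hr.1) ht0
    have h4 : C * |t - r| ≤ ε / 2 := by
      have : |t - r| ≤ τ := abs_le.2 ⟨by linarith [hr.2], by linarith [hr.1]⟩
      calc C * |t - r| ≤ C * τ := mul_le_mul_of_nonneg_left this hC0.le
        _ = ε / 2 := by rw [hτ]; field_simp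
    linarith
  have hle : sInf S ≤ potential G f (x (t + τ)) :=
    csInf_le hS ⟨t + τ, by simp only [Set.mem_Ici]; linarith, rfl⟩
  have hmono := hf.potential_antitone hx hT0 ht
  simp only [add_sub_cancel_left] at hdrop
  simp only at hT
  linarith

end

section

variable {N : ℕ} {a δ : ℝ} {f : Real.Angle → ℝ} {G : SimpleGraph (Fin N)} [DecidableRel G.Adj]

/-! ### Arcs and cuts -/

/-- Growing a set of agents along edges of angular length at most `L` either reaches all agents,
which then lie on an arc of length `(N - 1) L`, or stops at a cut crossed by long edges only. -/
theorem exists_lift_or_exists_cut (G : SimpleGraph (Fin N)) (hN : 0 < N) (x : Position N)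
    {L : ℝ} (hL : 0 ≤ L) :
    (∃ φ, proj φ = x ∧ ∀ i j, |φ i - φ j| ≤ ((N : ℝ) - 1) * L) ∨
      ∃ S : Finset (Fin N), S.Nonempty ∧ S ≠ Finset.univ ∧
        ∀ i ∈ S, ∀ j ∉ S, G.Adj i j → L < |(x j - x i).toReal| := by
  refine or_iff_not_imp_right.2 fun hcut => ?_
  push Not at hcut
  have grow : ∀ m : ℕ, m < N → ∃ (S : Finset (Fin N)) (φ : Fin N → ℝ), S.card = m + 1 ∧
      proj φ = x ∧ ∀ i ∈ S, ∀ j ∈ S, |φ i - φ j| ≤ m * L := by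
    intro m
    induction m with
    | zero =>
      intro _
      obtain ⟨φ, hφ⟩ := exists_proj_eq x
      exact ⟨{⟨0, hN⟩}, φ, by simp, hφ, by simp⟩
    | succ m ih =>
      intro hm
      obtain ⟨S, φ, hS, hφ, hdiam⟩ := ih (by omega)
      obtain ⟨i, hi, j, hj, -, hij⟩ := hcut S (Finset.card_pos.1 (by omega)) fun h => by
        rw [h, Finset.card_univ, Fintype.card_fin] at hS
        omega
      -- The new agent `j` gets the lift closest to that of its neighbor `i`.
      have hne : ∀ l ∈ S, l ≠ j := fun l hl h => hj (h ▸ hl)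
      have hnew : ∀ l ∈ S, |φ l - (φ i + (x j - x i).toReal)| ≤ (m + 1 : ℕ) * L := fun l hl => by
        have h := abs_sub (φ l - φ i) (x j - x i).toReal
        rw [sub_sub] at h
        push_cast
        linarith [hdiam l hl i hi]
      refine ⟨insert j S, Function.update φ j (φ i + (x j - x i).toReal),
        by rw [Finset.card_insert_of_notMem hj, hS], ?_, ?_⟩
      · funext l
        by_cases hl : l = j
        · subst hl
          have hi' : (φ i : Real.Angle) = x i := congrFun hφ i
          simp [proj, hi']
        · simpa [proj, hl] using congrFun hφ l
      · intro p hp q hq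
        rcases Finset.mem_insert.1 hp with rfl | hpS <;>
          rcases Finset.mem_insert.1 hq with rfl | hqS
        · simpa using by positivity
        · rw [abs_sub_comm, Function.update_self, Function.update_of_ne (hne q hqS)]
          exact hnew q hqS
        · rw [Function.update_self, Function.update_of_ne (hne p hpS)]
          exact hnew p hpS
        · rw [Function.update_of_ne (hne p hpS), Function.update_of_ne (hne q hqS)]
          refine (hdiam p hpS q hqS).trans ?_
          push_cast
          linarith
  obtain ⟨S, φ, hS, hφ, hdiam⟩ := grow (N - 1) (by omega)
  have huniv : S = Finset.univ := (Finset.card_eq_iff_eq_univ S).1 (by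
    rw [hS, Fintype.card_fin]
    omega)
  refine ⟨φ, hφ, fun i j => ?_⟩
  have h := hdiam i (by simp [huniv]) j (by simp [huniv])
  rwa [Nat.cast_pred hN] at h

theorem exists_adj_of_cut (hG : G.Connected) {S : Finset (Fin N)} (hS : S.Nonempty)
    (hS' : S ≠ Finset.univ) : ∃ i ∈ S, ∃ j ∉ S, G.Adj i j := by
  by_contra! h
  obtain ⟨i, hi⟩ := hS
  refine hS' (Finset.eq_univ_of_forall fun j => ?_)
  have hconst := eq_of_forall_adj_eq hG (x := fun k => k ∈ S) (fun p q hpq => propext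
    ⟨fun hp => by_contra fun hq => h p hp q hq hpq,
      fun hq => by_contra fun hp => h q hq p hp hpq.symm⟩) i j
  exact hconst ▸ hi

/-- An equilibrium on an open half-circle is synchronized: all neighbors of the foremost agent pull
it backwards, so they must be at the same position. -/
theorem IsSmoothedProfile.isSynchronized_of_lift (hf : IsSmoothedProfile N a δ f)
    (hG : G.Connected) {φ : Fin N → ℝ} (hφ : IsEquilibrium G f (proj φ))
    (hdiam : ∀ i j, |φ i - φ j| < Real.pi) : IsSynchronized (proj φ) := by
  have := hG.nonempty
  obtain ⟨m, hm⟩ := exists_eq_ciSup_of_finite (f := φ)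
  have hmax : ∀ j, φ j ≤ φ m := fun j => hm ▸ le_ciSup (Set.finite_range φ).bddAbove j
  have hle : ∀ i j, φ i = φ m → f ((φ j - φ i : ℝ) : Real.Angle) ≤ 0 := by
    intro i j hi
    rcases (hmax j).lt_or_eq with h | h
    · exact (hf.lift_neg (by linarith) (by linarith [abs_lt.1 (hdiam j i)])).le
    · rw [h, hi, sub_self]
      exact hf.map_zero.le
  have hstep : ∀ i j, G.Adj i j → φ i = φ m → φ j = φ m := by
    intro i j hij hi
    by_contra hne
    have hlt : φ j < φ m := lt_of_le_of_ne (hmax j) hne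
    have hneg : velocity G f (proj φ) i < 0 := by
      rw [velocity_proj]
      exact Finset.sum_neg' (fun l _ => hle i l hi) ⟨j, (G.mem_neighborFinset i j).2 hij,
        hf.lift_neg (by linarith) (by linarith [abs_lt.1 (hdiam j i)])⟩
    exact hneg.ne (hφ i)
  have hall : ∀ j, φ j = φ m := fun j => by
    have h := eq_of_forall_adj_eq hG (x := fun k => φ k = φ m)
      (fun p q hpq => propext ⟨hstep p q hpq, hstep q p hpq.symm⟩) m j
    exact h ▸ rfl
  intro j k
  simp only [proj, hall j, hall k]

/-- Rotating one side of a cut whose edges all lie in the region of negative slope strictly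
decreases the potential of an equilibrium: the first variation vanishes, and the second variation
is the sum of the negative slopes over the cut. -/
theorem IsSmoothedProfile.exists_potential_lt_of_cut (hf : IsSmoothedProfile N a δ f)
    (hδ : 0 < δ) (ha : 0 < a) (hN : 2 ≤ N) (hG : G.Connected) {x : Position N}
    (hx : IsEquilibrium G f x) {ρ : ℝ} (hρ : 0 < ρ) {S : Finset (Fin N)} (hS : S.Nonempty)
    (hS' : S ≠ Finset.univ)
    (hcut : ∀ i ∈ S, ∀ j ∉ S, G.Adj i j → Real.pi / N + δ + ρ ≤ |(x j - x i).toReal|)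
    {r : ℝ} (hr : 0 < r) : ∃ y, dist y x ≤ r ∧ potential G f y < potential G f x := by
  obtain ⟨θ, rfl⟩ := exists_proj_eq x
  set s : ℝ := min r ρ
  have hs : 0 < s := lt_min hr hρ
  set h : Fin N → ℝ := fun k => if k ∈ S then s else 0
  have habs : ∀ x : Position N, ∀ i j, |(x j - x i).toReal| = |(x i - x j).toReal| := by
    intro x i j
    rw [← norm_angle_eq_abs_toReal, ← norm_angle_eq_abs_toReal, norm_sub_rev]
  have hterm : ∀ k, ∀ j ∈ G.neighborFinset k,
      primitive f ((θ + h) j - (θ + h) k) = primitive f (θ j - θ k) +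
        f (proj θ j - proj θ k) * (h j - h k) - a / ((N : ℝ) - 1) / 2 * (h j - h k) ^ 2 := by
    intro k j hj
    have hadj := (G.mem_neighborFinset k j).1 hj
    have hlong : (k ∈ S ↔ j ∈ S) ∨ Real.pi / N + δ + ρ ≤ |(proj θ j - proj θ k).toReal| := by
      by_cases hk : k ∈ S <;> by_cases hj : j ∈ S
      · exact Or.inl (by tauto)
      · exact Or.inr (hcut k hk j hj hadj)
      · refine Or.inr ?_
        rw [habs]
        exact hcut j hj k hk hadj.symm
      · exact Or.inl (by tauto)
    rw [show (θ + h) j - (θ + h) k = (θ j - θ k) + (h j - h k) by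
      simp only [Pi.add_apply]; ring]
    rcases hlong with hiff | hlong
    · have h0 : h j - h k = 0 := by simp [h, hiff]
      simp [h0]
    · have hsρ : |h j - h k| ≤ ρ := by
        refine le_trans ?_ (min_le_right r ρ)
        change |(if j ∈ S then s else 0) - (if k ∈ S then s else 0)| ≤ s
        split_ifs <;> simp [abs_of_pos hs, hs.le]
      have := hf.primitive_add_sub hδ (d := θ j - θ k) hlong hsρ
      change _ = primitive f (θ j - θ k) + f ((θ j - θ k : ℝ) : Real.Angle) * (h j - h k) - _
      linarith
  refine ⟨proj (θ + h), (dist_proj_le _ _).trans ?_, ?_⟩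
  · refine (dist_pi_le_iff hr.le).2 fun k => ?_
    rw [Real.dist_eq, Pi.add_apply, add_sub_cancel_left]
    refine le_trans ?_ (min_le_left r ρ)
    change |if k ∈ S then s else 0| ≤ s
    split_ifs <;> simp [abs_of_pos hs, hs.le]
  · have hfirst : ∑ k, ∑ j ∈ G.neighborFinset k, f (proj θ j - proj θ k) * (h j - h k) = 0 := by
      rw [hf.sum_coupling_mul_sub G, Finset.sum_eq_zero fun k _ => by rw [hx k, zero_mul], mul_zero]
    have hsecond : 0 < ∑ k, ∑ j ∈ G.neighborFinset k, (h j - h k) ^ 2 := by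
      obtain ⟨i, hi, j, hj, hij⟩ := exists_adj_of_cut hG hS hS'
      refine Finset.sum_pos' (fun k _ => Finset.sum_nonneg fun j _ => sq_nonneg _)
        ⟨i, Finset.mem_univ i, Finset.sum_pos' (fun j _ => sq_nonneg _)
          ⟨j, (G.mem_neighborFinset i j).2 hij, ?_⟩⟩
      have : h j - h i = -s := by simp [h, hi, hj]
      rw [this, neg_sq]
      exact pow_pos hs 2
    have hcoef : 0 < a / ((N : ℝ) - 1) / 2 := by
      have : (2 : ℝ) ≤ N := by exact_mod_cast hN
      have : (0 : ℝ) < N - 1 := by linarith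
      positivity
    rw [hf.potential_proj G, hf.potential_proj G,
      Finset.sum_congr rfl fun k _ => Finset.sum_congr rfl (hterm k)]
    simp only [Finset.sum_sub_distrib, Finset.sum_add_distrib, ← Finset.mul_sum, hfirst]
    linarith [mul_pos hcoef hsecond]

/-! ### Stability of synchronization -/

theorem isCompact_configuration (x : Position N) : IsCompact (configuration x) :=
  isCompact_range (continuous_pi fun _ => continuous_const.add continuous_id)

theorem mem_configuration_self (x : Position N) : x ∈ configuration x := ⟨0, by simp⟩

theorem infDist_configuration_eq_zero_iff (x y : Position N) :
    Metric.infDist y (configuration x) = 0 ↔ y ∈ configuration x :=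
  ((isCompact_configuration x).isClosed.mem_iff_infDist_zero ⟨x, mem_configuration_self x⟩).symm

theorem configuration_eq_of_isSynchronized [Nonempty (Fin N)] {x : Position N}
    (hx : IsSynchronized x) : configuration x = {y | IsSynchronized y} := by
  ext y
  constructor
  · rintro ⟨c, rfl⟩ j k
    simp only [hx j k]
  · intro hy
    let i : Fin N := Classical.arbitrary _
    exact ⟨y i - x i, funext fun k => by simp [hx k i, hy k i]⟩

/-- Equilibria close to synchronization are synchronized. -/
theorem IsSmoothedProfile.exists_pos_isSynchronized (hf : IsSmoothedProfile N a δ f)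
    (hG : G.Connected) : ∃ r, 0 < r ∧ ∀ y, IsEquilibrium G f y →
      Metric.infDist y {y | IsSynchronized y} < r → IsSynchronized y := by
  have := hG.nonempty
  have hN : 0 < N := Fin.pos (Classical.arbitrary (Fin N))
  have hN' : (0 : ℝ) < N := Nat.cast_pos.2 hN
  have hpi := Real.pi_pos
  refine ⟨Real.pi / N / 2, by positivity, fun y hy hdist => ?_⟩
  obtain ⟨c, hc, hyc⟩ := (Metric.infDist_lt_iff (s := {y : Position N | IsSynchronized y})
    ⟨0, fun _ _ => rfl⟩).1 hdist
  have hshort : ∀ i j, |(y j - y i).toReal| ≤ Real.pi / N := by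
    intro i j
    rw [← norm_angle_eq_abs_toReal, ← dist_eq_norm]
    have h1 := dist_triangle_right (y j) (y i) (c i)
    have h2 := dist_le_pi_dist y c i
    have h3 := dist_le_pi_dist y c j
    rw [hc j i] at h3
    linarith
  rcases exists_lift_or_exists_cut G hN y (L := Real.pi / N) (by positivity) with
    ⟨φ, rfl, hφ⟩ | ⟨S, hS, hS', hcut⟩
  · refine hf.isSynchronized_of_lift hG hy fun i j => (hφ i j).trans_lt ?_
    have : Real.pi / N * N = Real.pi := by field_simp
    have : 0 < Real.pi / N := by positivity
    linarith
  · obtain ⟨i, hi, j, hj, hij⟩ := exists_adj_of_cut hG hS hS'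
    exact absurd (hcut i hi j hj hij) (hshort i j).not_gt

theorem IsSmoothedProfile.isAsymptoticallyStable_of_isSynchronized
    (hf : IsSmoothedProfile N a δ f) (hG : G.Connected) {x : Position N}
    (hx : IsSynchronized x) : IsAsymptoticallyStable G f x := by
  have := hG.nonempty
  have hconf := configuration_eq_of_isSynchronized hx
  have hzero : ∀ y : Position N,
      potential G f y = 0 ↔ Metric.infDist y (configuration x) = 0 := fun y => by
    rw [infDist_configuration_eq_zero_iff, hconf, hf.potential_eq_zero_iff hG]
    rfl
  -- The potential is a Lyapunov function vanishing exactly on the synchronized set.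
  have hstable : ∀ ε : ℝ, 0 < ε → ∃ η : ℝ, 0 < η ∧ ∀ y : ℝ → Position N, IsTrajectory G f y →
      Metric.infDist (y 0) (configuration x) < η →
        ∀ t : ℝ, 0 ≤ t → Metric.infDist (y t) (configuration x) < ε := by
    intro ε hε
    obtain ⟨m, hm, hmε⟩ := exists_pos_forall_lt_of_compactSpace (hf.continuous_potential G)
      (Metric.continuous_infDist_pt (configuration x)) (hf.potential_nonneg G)
      (fun y hy => ((hzero y).1 hy).le) hε
    obtain ⟨η, hη, hηm⟩ := exists_pos_forall_lt_of_compactSpace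
      (Metric.continuous_infDist_pt (configuration x)) (hf.continuous_potential G)
      (fun y => Metric.infDist_nonneg) (fun y hy => ((hzero y).2 hy).le) hm
    exact ⟨η, hη, fun y hy h0 t ht =>
      hmε _ ((hf.potential_antitone hy le_rfl ht).trans_lt (hηm _ h0))⟩
  refine ⟨hstable, ?_⟩
  obtain ⟨r, hr, hsync⟩ := hf.exists_pos_isSynchronized hG
  rw [← hconf] at hsync
  obtain ⟨η, hη, hηr⟩ := hstable (r / 2) (half_pos hr)
  refine ⟨η, hη, fun y hy h0 => ?_⟩
  -- The trajectory stays close to synchronization and approaches the equilibria, and the equilibria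
  -- it approaches are then close enough to synchronization to be synchronized.
  rw [Metric.tendsto_atTop]
  intro ε hε
  obtain ⟨T, hT⟩ := Metric.tendsto_atTop.1 (hf.tendsto_infDist_isEquilibrium hy)
    (min ε (r / 2)) (lt_min hε (half_pos hr))
  refine ⟨max T 0, fun t ht => ?_⟩
  have hlt := hT t ((le_max_left _ _).trans ht)
  rw [Real.dist_0_eq_abs, abs_of_nonneg Metric.infDist_nonneg] at hlt ⊢
  obtain ⟨e, he, hde⟩ := (Metric.infDist_lt_iff (s := {y | IsEquilibrium G f y})
    ⟨x, hf.isEquilibrium_of_isSynchronized hx⟩).1 hlt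
  have hnear := Metric.infDist_le_infDist_add_dist (s := configuration x) (x := e) (y := y t)
  rw [dist_comm e] at hnear
  have hes : e ∈ configuration x := by
    rw [hconf]
    refine hsync e he ?_
    linarith [hηr y hy h0 t ((le_max_right _ _).trans ht), hde.trans_le (min_le_right _ _)]
  exact (Metric.infDist_le_dist_of_mem hes).trans_lt (hde.trans_le (min_le_left _ _))

/-! ### Instability of the other equilibria -/

/-- An equilibrium with points of lower potential arbitrarily close by attracts no neighborhood:
a trajectory started at such a point keeps its potential below that of the equilibrium. -/
theorem IsSmoothedProfile.not_isAsymptoticallyStable (hf : IsSmoothedProfile N a δ f)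
    {x : Position N}
    (hlow : ∀ r : ℝ, 0 < r → ∃ y, dist y x ≤ r ∧ potential G f y < potential G f x) :
    ¬ IsAsymptoticallyStable G f x := by
  rintro ⟨-, η, hη, hattr⟩
  obtain ⟨y₀, hy₀, hlt⟩ := hlow (η / 2) (half_pos hη)
  obtain ⟨y, hy, rfl⟩ := hf.exists_isTrajectory G y₀
  have hlim := hattr y hy
    ((Metric.infDist_le_dist_of_mem (mem_configuration_self x)).trans_lt (by linarith))
  obtain ⟨ζ, hζ, hclose⟩ := exists_pos_forall_lt_of_compactSpace
    (Metric.continuous_infDist_pt (configuration x))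
    (v := fun z => potential G f x - potential G f z)
    (continuous_const.sub (hf.continuous_potential G))
    (fun z => Metric.infDist_nonneg) (fun z hz => by
      obtain ⟨c, rfl⟩ := (infDist_configuration_eq_zero_iff x z).1 hz
      simp [potential_add_const]) (sub_pos.2 hlt)
  obtain ⟨t, ht, ht0⟩ := ((hlim.eventually_lt_const hζ).and (eventually_ge_atTop 0)).exists
  linarith [hclose _ ht, hf.potential_antitone hy le_rfl ht0]

/-- If an equilibrium is not synchronized, the short edges do not connect all agents, since
otherwise the agents would lie on an open half-circle; the resulting cut lies in the region of
negative slope. -/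
theorem IsSmoothedProfile.isSynchronized_of_isAsymptoticallyStable
    (hf : IsSmoothedProfile N a δ f) (hδ : 0 < δ)
    (hδN : δ < Real.pi / ((N : ℝ) * ((N : ℝ) - 1))) (ha : 0 < a) (hN : 2 ≤ N)
    (hG : G.Connected) {x : Position N} (hx : IsEquilibrium G f x)
    (hstable : IsAsymptoticallyStable G f x) : IsSynchronized x := by
  have hN2 : (2 : ℝ) ≤ N := by exact_mod_cast hN
  have hN1 : (0 : ℝ) < N - 1 := by linarith
  -- The bound on `δ` says that the corners end before the angle `π / (N - 1)`.
  have hgap : Real.pi / N + δ < Real.pi / ((N : ℝ) - 1) := by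
    have : Real.pi / N + Real.pi / ((N : ℝ) * ((N : ℝ) - 1)) = Real.pi / ((N : ℝ) - 1) := by
      field_simp
      ring
    linarith
  obtain ⟨L, hL0, hL1⟩ := exists_between hgap
  have hpi : 0 ≤ Real.pi / N := by positivity
  rcases exists_lift_or_exists_cut G (by omega) x (L := L) (by linarith) with
    ⟨φ, rfl, hφ⟩ | ⟨S, hS, hS', hcut⟩
  · refine hf.isSynchronized_of_lift hG hx fun i j => (hφ i j).trans_lt ?_
    rwa [lt_div_iff₀ hN1, mul_comm] at hL1
  · refine absurd hstable (hf.not_isAsymptoticallyStable fun r hr =>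
      hf.exists_potential_lt_of_cut hδ ha hN hG hx (ρ := L - (Real.pi / N + δ))
        (sub_pos.2 hL0) hS hS' (fun i hi j hj hij => ?_) hr)
    linarith [hcut i hi j hj hij]

end

end CircleSync

theorem mainTheorem1 (N : ℕ) (hN : 2 ≤ N) (a : ℝ) (ha : 0 < a) (δ : ℝ) (hδ : 0 < δ)
    (hδN : δ < Real.pi / ((N : ℝ) * ((N : ℝ) - 1)))
    (f : Real.Angle → ℝ) (hf : CircleSync.IsSmoothedProfile N a δ f)
    (G : SimpleGraph (Fin N)) [DecidableRel G.Adj] (hG : G.Connected) :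
    (∀ x : CircleSync.Position N, CircleSync.IsEquilibrium G f x ↔
      CircleSync.IsCriticalPoint (CircleSync.potential G f) x) ∧
    (∀ x : ℝ → CircleSync.Position N, CircleSync.IsTrajectory G f x →
      Tendsto (fun t => Metric.infDist (x t)
        {y | CircleSync.IsCriticalPoint (CircleSync.potential G f) y}) atTop (𝓝 0)) ∧
    (∀ x : CircleSync.Position N,
      (CircleSync.IsEquilibrium G f x ∧ CircleSync.IsAsymptoticallyStable G f x) ↔
        CircleSync.IsSynchronized x) := by
  refine ⟨hf.isEquilibrium_iff_isCriticalPoint G, fun x hx => ?_, fun x => ⟨fun h => ?_, fun h => ?_⟩⟩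
  · simp only [← hf.isEquilibrium_iff_isCriticalPoint G]
    exact hf.tendsto_infDist_isEquilibrium hx
  · exact hf.isSynchronized_of_isAsymptoticallyStable hδ hδN ha hN hG h.1 h.2
  · exact ⟨hf.isEquilibrium_of_isSynchronized h, hf.isAsymptoticallyStable_of_isSynchronized hG h⟩
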